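/- Let $\gamma$ denote Euler's constant and, for integers $N\ge 1$, let $$S_N=\sum_{k=1}^{N}\left(\frac1k-\log\frac{k+1}{k}\right)=\sum_{k=1}^N\frac1k-\log(N+1).$$ Let $c,m,r$ be positive integers. Then for every positive integer $n$ one has $$\left|\gamma-\frac{((2cn)!)^m}{(2mcn)!\,r^{2mcn}}\sum_{k=0}^{2mcn}(-1)^k\binom{2mcn}{k}\left(\prod_{j=1}^m\binom{rk+2jcn+j}{2cn}\right)S_{rk+(2m-1)cn+m}\right| <\frac{m^m}{(m-1)!}\left(\frac{4^{-c}\left(1-\frac{1}{2m}\right)^{\frac{(2m-1)c}{r}}}{\left(r+1-\frac{1}{2m}\right)^{2mc+\frac{(2m-1)c}{r}}}\right)^n .$$ -/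

import Mathlib

/-- The partial sums `S_N(α) = ∑_{k=1}^N (1/(k+α) - log((k+α+1)/(k+α)))`. -/
noncomputable def eulerPartialSumShift (α : ℝ) (N : ℕ) : ℝ :=
  ∑ k ∈ Finset.Icc 1 N, (1 / ((k : ℝ) + α) - Real.log (((k : ℝ) + α + 1) / ((k : ℝ) + α)))

/-- `S_N = S_N(0) = ∑_{k=1}^N (1/k - log((k+1)/k))`. -/
noncomputable def eulerPartialSum (N : ℕ) : ℝ :=
  eulerPartialSumShift 0 N

/-- The alternating binomial sum `∑ (-1)^k (L choose k) f k`. -/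
noncomputable def altSum (L : ℕ) (f : ℕ → ℝ) : ℝ :=
  ∑ k ∈ Finset.range (L + 1), (-1 : ℝ) ^ k * (L.choose k : ℝ) * f k

/-! Put `h = cn`, `L = 2mh`, `q = (2m-1)h + m`. Up to the factor `(2h)!^m`, the product of binomials
is a polynomial `A(k)` of degree exactly `L`, so `altSum L A = L! r^L`, and the quantity to bound is
`altSum` of `A(k) (γ - S_{rk+q})` divided by `L! r^L`.

The difference `γ - S_N` is the integral over `s ∈ [0,1]` of `∑_{k>N} (1/k - 1/(k+s)) = ∫₀¹ x^N
(1-x^s)/(1-x) dx`, and `(1-x^s)/(1-x)` is a positive mixture of the kernels `1/(x+t)`, `t > 0`.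
Hence it suffices to bound `altSum` of `A(k) ∫₀¹ x^(rk+q)/(x+t) dx` by `C/t`.

Integration by parts absorbs the linear factors of `A` into kernels `x^e t^d/(x+t)^(e+d+1)`: the
factor `rk+q+1+e` raises `e`, the factor `rk+q-d` raises `d` (`MomentBound.raise_left`,
`MomentBound.raise_right`). Boundary terms vanish because the remaining polynomial has degree below
`L`. The top block of `A` is centred at `q` and is split evenly, so `e` ends at `h`; the other
blocks raise only `d`. One value is missing between consecutive blocks, and `MomentBound.skip`
crosses this gap by averaging over scales.

Once `A` is used up, the integrand is `x^q (1-x^r)^L ≥ 0` times a kernel at most `4^(-h)/t`.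
Maximising `x^((2m-1)h) (1-x^r)^L` gives the geometric rate, and the spare `x^m` makes the
inequality strict. -/

/-! ### Alternating binomial sums of polynomials -/

theorem altSum_congr {L : ℕ} {f g : ℕ → ℝ} (h : ∀ k, f k = g k) : altSum L f = altSum L g := by
  rw [funext h]

theorem altSum_add (L : ℕ) (f g : ℕ → ℝ) :
    altSum L (fun k => f k + g k) = altSum L f + altSum L g := by
  simp only [altSum, mul_add, Finset.sum_add_distrib]

theorem altSum_sub (L : ℕ) (f g : ℕ → ℝ) :
    altSum L (fun k => f k - g k) = altSum L f - altSum L g := by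
  simp only [altSum, mul_sub, Finset.sum_sub_distrib]

theorem altSum_const_mul (L : ℕ) (c : ℝ) (f : ℕ → ℝ) :
    altSum L (fun k => c * f k) = c * altSum L f := by
  simp only [altSum, Finset.mul_sum]
  exact Finset.sum_congr rfl fun k _ => by ring

theorem altSum_mul_const (L : ℕ) (c : ℝ) (f : ℕ → ℝ) :
    altSum L (fun k => f k * c) = altSum L f * c := by
  simp only [altSum, Finset.sum_mul]
  exact Finset.sum_congr rfl fun k _ => by ring

theorem altSum_eval_eq_fwdDiff (L : ℕ) (P : Polynomial ℝ) :
    altSum L (fun k => P.eval (k : ℝ)) = (-1) ^ L * (fwdDiff (1 : ℝ))^[L] P.eval 0 := by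
  rw [fwdDiff_iter_eq_sum_shift, Finset.mul_sum, altSum]
  refine Finset.sum_congr rfl fun k hk => ?_
  have hk' : k ≤ L := Nat.lt_succ_iff.mp (Finset.mem_range.mp hk)
  obtain ⟨j, rfl⟩ := Nat.exists_eq_add_of_le hk'
  simp only [zsmul_eq_mul, zero_add, nsmul_eq_mul, mul_one]
  push_cast
  rw [Nat.add_sub_cancel_left, pow_add]
  have : ((-1 : ℝ) ^ j) * (-1) ^ j = 1 := by rw [← mul_pow]; simp
  linear_combination (-(-1) ^ k * ((k + j).choose k : ℝ) * P.eval (k : ℝ)) * this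

theorem altSum_eval_eq_zero {L : ℕ} {P : Polynomial ℝ} (hP : P.natDegree < L) :
    altSum L (fun k => P.eval (k : ℝ)) = 0 := by
  rw [altSum_eval_eq_fwdDiff, Polynomial.fwdDiff_iter_eq_zero_of_degree_lt hP]
  simp

theorem altSum_eval_natDegree (P : Polynomial ℝ) :
    altSum P.natDegree (fun k => P.eval (k : ℝ)) =
      (-1) ^ P.natDegree * (P.leadingCoeff * (P.natDegree.factorial : ℝ)) := by
  rw [altSum_eval_eq_fwdDiff, Polynomial.fwdDiff_iter_degree_eq_factorial]
  simp

/-! ### Kernels and integration by parts -/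

/-- The kernel `x^e t^d / (x + t)^(e+d+1)`. -/
noncomputable def stieltjesKernel (e d : ℕ) (t x : ℝ) : ℝ :=
  x ^ e * t ^ d / (x + t) ^ (e + d + 1)

/-- The `N`-th moment of the kernel over `[0, 1]`. -/
noncomputable def kernelMoment (e d : ℕ) (t : ℝ) (N : ℕ) : ℝ :=
  ∫ x in (0 : ℝ)..1, x ^ N * stieltjesKernel e d t x

theorem continuousOn_stieltjesKernel (e d : ℕ) {t : ℝ} (ht : 0 < t) :
    ContinuousOn (stieltjesKernel e d t) (Set.Icc 0 1) := by
  unfold stieltjesKernel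
  refine ContinuousOn.div (by fun_prop) (by fun_prop) fun x hx => ?_
  have := hx.1
  positivity

theorem intervalIntegrable_pow_mul_stieltjesKernel (e d : ℕ) {t : ℝ} (ht : 0 < t) (N : ℕ) :
    IntervalIntegrable (fun x => x ^ N * stieltjesKernel e d t x) MeasureTheory.volume 0 1 := by
  apply ContinuousOn.intervalIntegrable
  rw [Set.uIcc_of_le zero_le_one]
  exact ContinuousOn.mul (by fun_prop) (continuousOn_stieltjesKernel e d ht)

theorem hasDerivAt_pow_succ_mul_stieltjesKernel (e d N : ℕ) {t x : ℝ} (ht : 0 < t) (hx : 0 ≤ x) :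
    HasDerivAt (fun x => x ^ (N + 1) * stieltjesKernel e d t x)
      ((N + 1 + e) * (x ^ N * stieltjesKernel e d t x) -
        (e + d + 1) * (x ^ N * stieltjesKernel (e + 1) d t x)) x := by
  have hxt : x + t ≠ 0 := by positivity
  unfold stieltjesKernel
  have h1 : HasDerivAt (fun x : ℝ => x ^ (N + 1 + e) * t ^ d / (x + t) ^ (e + d + 1))
      ((((N + 1 + e : ℕ) : ℝ) * x ^ (N + e) * t ^ d * (x + t) ^ (e + d + 1) -
        x ^ (N + 1 + e) * t ^ d * (((e + d + 1 : ℕ) : ℝ) * (x + t) ^ (e + d) * 1)) /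
        ((x + t) ^ (e + d + 1)) ^ 2) x := by
    refine HasDerivAt.div ?_ ?_ (pow_ne_zero _ hxt)
    · have := (hasDerivAt_pow (N + 1 + e) x).mul_const (t ^ d)
      rwa [show N + 1 + e - 1 = N + e by omega] at this
    · have := ((hasDerivAt_id x).add_const t).fun_pow (e + d + 1)
      simpa using this
  have hf : (fun x : ℝ => x ^ (N + 1) * (x ^ e * t ^ d / (x + t) ^ (e + d + 1))) =
      fun x : ℝ => x ^ (N + 1 + e) * t ^ d / (x + t) ^ (e + d + 1) := by
    funext y; rw [pow_add y (N + 1) e]; ring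
  rw [hf]
  convert h1 using 1
  push_cast
  rw [show e + 1 + d + 1 = (e + d) + 2 by ring]
  field_simp
  ring

theorem stieltjesKernel_combination (e d : ℕ) {t x : ℝ} (ht : 0 < t) (hx : 0 ≤ x) :
    stieltjesKernel e d t x = stieltjesKernel (e + 1) d t x + stieltjesKernel e (d + 1) t x := by
  have hxt : x + t ≠ 0 := by positivity
  unfold stieltjesKernel
  rw [show e + 1 + d + 1 = (e + d) + 2 by ring, show e + (d + 1) + 1 = (e + d) + 2 by ring]
  field_simp
  ring

theorem kernelMoment_combination (e d : ℕ) {t : ℝ} (ht : 0 < t) (N : ℕ) :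
    kernelMoment e d t N = kernelMoment (e + 1) d t N + kernelMoment e (d + 1) t N := by
  unfold kernelMoment
  rw [← intervalIntegral.integral_add (intervalIntegrable_pow_mul_stieltjesKernel _ _ ht N)
    (intervalIntegrable_pow_mul_stieltjesKernel _ _ ht N)]
  refine intervalIntegral.integral_congr fun x hx => ?_
  rw [Set.uIcc_of_le zero_le_one] at hx
  rw [stieltjesKernel_combination e d ht hx.1]
  ring

theorem kernelMoment_raise_left (e d : ℕ) {t : ℝ} (ht : 0 < t) (N : ℕ) :
    (N + 1 + e) * kernelMoment e d t N =
      stieltjesKernel e d t 1 + (e + d + 1) * kernelMoment (e + 1) d t N := by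
  have hi1 := (intervalIntegrable_pow_mul_stieltjesKernel e d ht N).const_mul ((N : ℝ) + 1 + e)
  have hi2 := (intervalIntegrable_pow_mul_stieltjesKernel (e + 1) d ht N).const_mul
    ((e : ℝ) + d + 1)
  have h := intervalIntegral.integral_eq_sub_of_hasDerivAt
    (f := fun x => x ^ (N + 1) * stieltjesKernel e d t x) (a := 0) (b := 1)
    (fun x hx => hasDerivAt_pow_succ_mul_stieltjesKernel e d N ht
      (by rw [Set.uIcc_of_le zero_le_one] at hx; exact hx.1)) (hi1.sub hi2)
  rw [intervalIntegral.integral_sub hi1 hi2, intervalIntegral.integral_const_mul,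
    intervalIntegral.integral_const_mul] at h
  simp only [one_pow, one_mul, ne_eq, Nat.succ_ne_zero, not_false_eq_true, zero_pow, zero_mul,
    sub_zero] at h
  unfold kernelMoment
  linarith

/-- Eliminates the moment with `e` raised between the integration by parts and the splitting `1 =
x/(x+t) + t/(x+t)`. -/
theorem kernelMoment_raise_right (e d : ℕ) {t : ℝ} (ht : 0 < t) (N : ℕ) :
    ((N : ℝ) - d) * kernelMoment e d t N =
      stieltjesKernel e d t 1 - (e + d + 1) * kernelMoment e (d + 1) t N := by
  have h1 := kernelMoment_raise_left e d ht N
  have h2 := kernelMoment_combination e d ht N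
  linear_combination h1 - (e + d + 1) * h2

/-! ### Trading linear factors for kernel exponents -/

/-- The alternating sum of the kernel moments, weighted by the values of a polynomial. -/
noncomputable def weightedMoment (L r q : ℕ) (A : Polynomial ℝ) (e d : ℕ) (t : ℝ) : ℝ :=
  altSum L fun k => A.eval (k : ℝ) * kernelMoment e d t (r * k + q)

/-- `weightedMoment` is bounded by `C / t`. -/
def MomentBound (L r q : ℕ) (A : Polynomial ℝ) (e d : ℕ) (C : ℝ) : Prop :=
  ∀ t : ℝ, 0 < t → |weightedMoment L r q A e d t| ≤ C / t

/-- The polynomial `r X + b`. -/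
noncomputable def linPoly (r : ℕ) (b : ℝ) : Polynomial ℝ :=
  Polynomial.C (r : ℝ) * Polynomial.X + Polynomial.C b

theorem eval_linPoly (r : ℕ) (b x : ℝ) : (linPoly r b).eval x = r * x + b := by
  simp [linPoly]

theorem natDegree_linPoly_le (r : ℕ) (b : ℝ) : (linPoly r b).natDegree ≤ 1 :=
  Polynomial.natDegree_linear_le

/-- The boundary value at `x = 1` does not depend on `k`, so it contributes a multiple of `altSum L
A`, which is zero since `A` has degree below `L`. -/
theorem MomentBound.raise_left {L r q : ℕ} {A : Polynomial ℝ} {e d : ℕ} {C : ℝ}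
    (hA : A.natDegree < L) (h : MomentBound L r q A (e + 1) d C) :
    MomentBound L r q (A * linPoly r (q + 1 + e)) e d ((e + d + 1) * C) := by
  intro t ht
  have key : weightedMoment L r q (A * linPoly r (q + 1 + e)) e d t =
      (e + d + 1) * weightedMoment L r q A (e + 1) d t := by
    have h0 := altSum_eval_eq_zero hA
    have : ∀ k : ℕ, (A * linPoly r (q + 1 + e)).eval (k : ℝ) * kernelMoment e d t (r * k + q) =
        A.eval (k : ℝ) * stieltjesKernel e d t 1 +
          (e + d + 1) * (A.eval (k : ℝ) * kernelMoment (e + 1) d t (r * k + q)) := by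
      intro k
      have := kernelMoment_raise_left e d ht (r * k + q)
      push_cast at this
      rw [Polynomial.eval_mul, eval_linPoly]
      linear_combination (A.eval (k : ℝ)) * this
    unfold weightedMoment
    rw [altSum_congr this, altSum_add, altSum_mul_const, altSum_const_mul, h0]
    ring
  rw [key, abs_mul, abs_of_nonneg (by positivity), mul_div_assoc]
  exact mul_le_mul_of_nonneg_left (h t ht) (by positivity)

theorem MomentBound.raise_right {L r q : ℕ} {A : Polynomial ℝ} {e d : ℕ} {C : ℝ}
    (hA : A.natDegree < L) (h : MomentBound L r q A e (d + 1) C) :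
    MomentBound L r q (A * linPoly r (q - d)) e d ((e + d + 1) * C) := by
  intro t ht
  have key : weightedMoment L r q (A * linPoly r (q - d)) e d t =
      -(e + d + 1) * weightedMoment L r q A e (d + 1) t := by
    have h0 := altSum_eval_eq_zero hA
    have : ∀ k : ℕ, (A * linPoly r (q - d)).eval (k : ℝ) * kernelMoment e d t (r * k + q) =
        A.eval (k : ℝ) * stieltjesKernel e d t 1 +
          -(e + d + 1) * (A.eval (k : ℝ) * kernelMoment e (d + 1) t (r * k + q)) := by
      intro k
      have := kernelMoment_raise_right e d ht (r * k + q)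
      push_cast at this
      rw [Polynomial.eval_mul, eval_linPoly]
      linear_combination (A.eval (k : ℝ)) * this
    unfold weightedMoment
    rw [altSum_congr this, altSum_add, altSum_mul_const, altSum_const_mul, h0]
    ring
  rw [key, abs_mul, abs_neg, abs_of_nonneg (by positivity), mul_div_assoc]
  exact mul_le_mul_of_nonneg_left (h t ht) (by positivity)

theorem MomentBound.raise_left_iterate {L r q : ℕ} {d : ℕ} (a : ℕ) {A : Polynomial ℝ} {e : ℕ}
    {C : ℝ} (hA : A.natDegree + a ≤ L) (h : MomentBound L r q A (e + a) d C) :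
    MomentBound L r q (A * ∏ i ∈ Finset.range a, linPoly r (q + 1 + (e + i))) e d
      ((∏ i ∈ Finset.range a, ((e : ℝ) + i + d + 1)) * C) := by
  induction a generalizing A C with
  | zero => simpa using h
  | succ a ih =>
    have h1 := MomentBound.raise_left (e := e + a) (by omega) h
    have h2 := ih (by
      have := Polynomial.natDegree_mul_le (p := A) (q := linPoly r (q + 1 + ((e + a : ℕ) : ℝ)))
      have := natDegree_linPoly_le r (q + 1 + ((e + a : ℕ) : ℝ))
      omega) h1
    rw [Finset.prod_range_succ, Finset.prod_range_succ]
    push_cast at h2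
    convert h2 using 1 <;> ring

theorem MomentBound.raise_right_iterate {L r q : ℕ} {e : ℕ} (a : ℕ) {A : Polynomial ℝ} {d : ℕ}
    {C : ℝ} (hA : A.natDegree + a ≤ L) (h : MomentBound L r q A e (d + a) C) :
    MomentBound L r q (A * ∏ i ∈ Finset.range a, linPoly r (q - (d + i))) e d
      ((∏ i ∈ Finset.range a, ((e : ℝ) + (d + i) + 1)) * C) := by
  induction a generalizing A C with
  | zero => simpa using h
  | succ a ih =>
    have h1 := MomentBound.raise_right (d := d + a) (by omega) h
    have h2 := ih (by
      have := Polynomial.natDegree_mul_le (p := A) (q := linPoly r (q - ((d + a : ℕ) : ℝ)))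
      have := natDegree_linPoly_le r (q - ((d + a : ℕ) : ℝ))
      omega) h1
    rw [Finset.prod_range_succ, Finset.prod_range_succ]
    push_cast at h2
    convert h2 using 1 <;> ring

/-! ### Integral form and averaging over scales -/

/-- The polynomial function `∑ (-1)^k (L choose k) A(k) x^(r k + q)`. -/
noncomputable def weightFun (L r q : ℕ) (A : Polynomial ℝ) (x : ℝ) : ℝ :=
  altSum L fun k => A.eval (k : ℝ) * x ^ (r * k + q)

theorem continuous_weightFun (L r q : ℕ) (A : Polynomial ℝ) : Continuous (weightFun L r q A) := by
  unfold weightFun altSum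
  fun_prop

theorem altSum_mul_integral (L r q : ℕ) (A : Polynomial ℝ) {g : ℝ → ℝ}
    (hg : ∀ N : ℕ, IntervalIntegrable (fun x => x ^ N * g x) MeasureTheory.volume 0 1) :
    (altSum L fun k => A.eval (k : ℝ) * ∫ x in (0 : ℝ)..1, x ^ (r * k + q) * g x) =
      ∫ x in (0 : ℝ)..1, weightFun L r q A x * g x := by
  unfold weightFun altSum
  simp only [Finset.sum_mul]
  rw [intervalIntegral.integral_finsetSum]
  · refine Finset.sum_congr rfl fun k _ => ?_
    rw [← intervalIntegral.integral_const_mul, ← intervalIntegral.integral_const_mul]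
    refine intervalIntegral.integral_congr fun x _ => ?_
    ring
  · intro k _
    refine ((hg (r * k + q)).const_mul ((-1) ^ k * (L.choose k : ℝ) * A.eval (k : ℝ))).congr ?_
    exact fun x _ => by ring

theorem weightedMoment_eq_integral (L r q : ℕ) (A : Polynomial ℝ) (e d : ℕ) {t : ℝ} (ht : 0 < t) :
    weightedMoment L r q A e d t =
      ∫ x in (0 : ℝ)..1, weightFun L r q A x * stieltjesKernel e d t x :=
  altSum_mul_integral L r q A (intervalIntegrable_pow_mul_stieltjesKernel e d ht)

/-- The integrand, with its constant, is the `v`-derivative of `v^(e+d+2) x^e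
t^(d+1)/(xv+t)^(e+d+2)`, which vanishes at `v = 0` and is the kernel at `v = 1`. -/
theorem stieltjesKernel_eq_integral (e d : ℕ) {t x : ℝ} (ht : 0 < t) (hx : 0 ≤ x) :
    stieltjesKernel e (d + 1) t x = (e + d + 2) *
      ∫ v in (0 : ℝ)..1, v ^ (e + d + 1) * x ^ e * t ^ (d + 2) / (x * v + t) ^ (e + d + 3) := by
  have hpos : ∀ v ∈ Set.uIcc (0 : ℝ) 1, x * v + t ≠ 0 := by
    intro v hv
    rw [Set.uIcc_of_le zero_le_one] at hv
    have := hv.1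
    positivity
  have hd : ∀ v ∈ Set.uIcc (0 : ℝ) 1,
      HasDerivAt (fun v => v ^ (e + d + 2) * (x ^ e * t ^ (d + 1)) / (x * v + t) ^ (e + d + 2))
        ((e + d + 2) *
          (v ^ (e + d + 1) * x ^ e * t ^ (d + 2) / (x * v + t) ^ (e + d + 3))) v := by
    intro v hv
    have hv0 := hpos v hv
    have h1 := (hasDerivAt_pow (e + d + 2) v).mul_const (x ^ e * t ^ (d + 1))
    have h2 := ((((hasDerivAt_id v).const_mul x).add_const t).fun_pow (e + d + 2))
    have h3 := h1.div h2 (pow_ne_zero _ hv0)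
    refine h3.congr_deriv ?_
    simp only [id, show e + d + 2 - 1 = e + d + 1 by omega]
    push_cast
    field_simp
    ring
  have hi : IntervalIntegrable (fun v => ((e : ℝ) + d + 2) *
      (v ^ (e + d + 1) * x ^ e * t ^ (d + 2) / (x * v + t) ^ (e + d + 3)))
      MeasureTheory.volume 0 1 := by
    apply ContinuousOn.intervalIntegrable
    refine ContinuousOn.mul continuousOn_const
      (ContinuousOn.div (by fun_prop) (by fun_prop) fun v hv => pow_ne_zero _ (hpos v hv))
  have := intervalIntegral.integral_eq_sub_of_hasDerivAt hd hi
  rw [intervalIntegral.integral_const_mul] at this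
  rw [this]
  unfold stieltjesKernel
  simp
  rfl

theorem integral_mul_stieltjesKernel (e d : ℕ) {t : ℝ} (ht : 0 < t) {W : ℝ → ℝ}
    (hW : Continuous W) :
    ∫ x in (0 : ℝ)..1, W x * stieltjesKernel e (d + 1) t x =
      (e + d + 2) * ∫ v in (0 : ℝ)..1,
        v ^ d * ∫ x in (0 : ℝ)..1, W x * stieltjesKernel e (d + 2) (t / v) x := by
  set F : ℝ → ℝ → ℝ := fun x v =>
    W x * (v ^ (e + d + 1) * x ^ e * t ^ (d + 2) / (x * v + t) ^ (e + d + 3)) with hF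
  have h1 : ∫ x in (0 : ℝ)..1, W x * stieltjesKernel e (d + 1) t x =
      (e + d + 2) * ∫ x in (0 : ℝ)..1, ∫ v in (0 : ℝ)..1, F x v := by
    rw [← intervalIntegral.integral_const_mul]
    refine intervalIntegral.integral_congr fun x hx => ?_
    rw [Set.uIcc_of_le zero_le_one] at hx
    simp only [hF]
    rw [stieltjesKernel_eq_integral e d ht hx.1, intervalIntegral.integral_const_mul]
    ring
  have hint : MeasureTheory.IntegrableOn F.uncurry (Set.uIoc (0 : ℝ) 1 ×ˢ Set.uIoc (0 : ℝ) 1) := by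
    have hc : ContinuousOn F.uncurry (Set.Icc (0 : ℝ) 1 ×ˢ Set.Icc (0 : ℝ) 1) := by
      simp only [hF, Function.uncurry_def]
      refine ContinuousOn.mul (by fun_prop) (ContinuousOn.div (by fun_prop) (by fun_prop) ?_)
      rintro ⟨x, v⟩ ⟨hx, hv⟩
      have := hx.1
      have := hv.1
      simp only at *
      positivity
    refine (hc.integrableOn_compact (isCompact_Icc.prod isCompact_Icc)).mono_set ?_
    rw [Set.uIoc_of_le zero_le_one]
    exact Set.prod_mono Set.Ioc_subset_Icc_self Set.Ioc_subset_Icc_self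
  rw [h1, MeasureTheory.intervalIntegral_intervalIntegral_swap hint]
  congr 1
  -- The half-open interval excludes `v = 0`, where the scale `t / v` is meaningless.
  refine intervalIntegral.integral_congr_ae (Filter.Eventually.of_forall fun v hv => ?_)
  rw [Set.uIoc_of_le zero_le_one] at hv
  have hv0 : 0 < v := hv.1
  rw [← intervalIntegral.integral_const_mul]
  refine intervalIntegral.integral_congr fun x hx => ?_
  rw [Set.uIcc_of_le zero_le_one] at hx
  have hx0 := hx.1
  have hne : x * v + t ≠ 0 := by positivity
  simp only [hF, stieltjesKernel]
  have : x + t / v = (x * v + t) / v := by field_simp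
  rw [this, div_pow, div_pow]
  field_simp
  ring

/-- Lowers `d` without acquiring a linear factor: the kernel is an average of kernels with larger
`d` at scales `t / v`. A bound of the form `C / t` survives, since `C / (t / v)` only adds a power
of `v` to integrate. -/
theorem MomentBound.skip {L r q : ℕ} {A : Polynomial ℝ} {e d : ℕ} {C : ℝ} (hd : 1 ≤ d)
    (h : MomentBound L r q A e (d + 1) C) :
    MomentBound L r q A e d ((e + d + 1) / (d + 1) * C) := by
  obtain ⟨d, rfl⟩ : ∃ j, d = j + 1 := ⟨d - 1, by omega⟩
  intro t ht
  rw [weightedMoment_eq_integral _ _ _ _ _ _ ht,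
    integral_mul_stieltjesKernel e d ht (continuous_weightFun L r q A), abs_mul,
    abs_of_nonneg (by positivity : (0 : ℝ) ≤ e + d + 2)]
  have hle : |∫ v in (0 : ℝ)..1, v ^ d *
      ∫ x in (0 : ℝ)..1, weightFun L r q A x * stieltjesKernel e (d + 2) (t / v) x| ≤
      ∫ v in (0 : ℝ)..1, v ^ (d + 1) * (C / t) := by
    rw [← Real.norm_eq_abs]
    refine intervalIntegral.norm_integral_le_of_norm_le zero_le_one
      (Filter.Eventually.of_forall fun v hv => ?_) (by
        apply Continuous.intervalIntegrable; fun_prop)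
    have hv0 : 0 < v := hv.1
    have htv : 0 < t / v := by positivity
    rw [← weightedMoment_eq_integral _ _ _ _ _ _ htv, Real.norm_eq_abs, abs_mul,
      abs_of_pos (by positivity : 0 < v ^ d)]
    calc v ^ d * |weightedMoment L r q A e (d + 2) (t / v)| ≤ v ^ d * (C / (t / v)) :=
          mul_le_mul_of_nonneg_left (h _ htv) (by positivity)
      _ = v ^ (d + 1) * (C / t) := by field_simp; ring
  rw [intervalIntegral.integral_mul_const, integral_pow] at hle
  calc (e + d + 2 : ℝ) * _ ≤ (e + d + 2) * ((1 ^ (d + 1 + 1) - 0 ^ (d + 1 + 1)) /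
          (((d + 1 : ℕ) : ℝ) + 1) * (C / t)) := mul_le_mul_of_nonneg_left hle (by positivity)
    _ = _ := by
      push_cast
      simp
      ring

/-! ### Integral representation of the partial sums -/

/-- The moments `∫₀¹ x^N (1 - x^s) / (1 - x) dx`. -/
noncomputable def rpowTail (s : ℝ) (N : ℕ) : ℝ :=
  ∫ x in (0 : ℝ)..1, x ^ N * ((1 - x ^ s) / (1 - x))

theorem one_sub_rpow_div_nonneg {s x : ℝ} (hs : 0 ≤ s) (hx0 : 0 ≤ x) (hx1 : x ≤ 1) :
    0 ≤ (1 - x ^ s) / (1 - x) :=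
  div_nonneg (sub_nonneg.mpr (Real.rpow_le_one hx0 hx1 hs)) (sub_nonneg.mpr hx1)

theorem one_sub_rpow_div_le_one {s x : ℝ} (hs1 : s ≤ 1) (hx0 : 0 ≤ x) (hx1 : x ≤ 1) :
    (1 - x ^ s) / (1 - x) ≤ 1 := by
  refine div_le_one_of_le₀ ?_ (sub_nonneg.mpr hx1)
  rcases hx0.eq_or_lt with h | h
  · subst h
    have := Real.rpow_nonneg (le_refl (0 : ℝ)) s
    linarith
  · have := Real.rpow_le_rpow_of_exponent_ge h hx1 hs1
    rw [Real.rpow_one] at this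
    linarith

theorem intervalIntegrable_pow_mul_rpow_div {s : ℝ} (hs0 : 0 ≤ s) (hs1 : s ≤ 1) (N : ℕ) :
    IntervalIntegrable (fun x : ℝ => x ^ N * ((1 - x ^ s) / (1 - x))) MeasureTheory.volume 0 1 := by
  rw [intervalIntegrable_iff_integrableOn_Ioc_of_le zero_le_one]
  refine MeasureTheory.Integrable.mono' (g := fun _ => (1 : ℝ)) ?_ ?_ ?_
  · simp
  · exact Measurable.aestronglyMeasurable (by fun_prop)
  · refine MeasureTheory.ae_restrict_of_forall_mem measurableSet_Ioc fun _ hx => ?_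
    have h0 := one_sub_rpow_div_nonneg hs0 hx.1.le hx.2
    rw [Real.norm_eq_abs, abs_of_nonneg (mul_nonneg (pow_nonneg hx.1.le _) h0)]
    exact mul_le_one₀ (pow_le_one₀ hx.1.le hx.2) h0 (one_sub_rpow_div_le_one hs1 hx.1.le hx.2)

theorem rpowTail_nonneg {s : ℝ} (hs0 : 0 ≤ s) (N : ℕ) : 0 ≤ rpowTail s N :=
  intervalIntegral.integral_nonneg zero_le_one fun _ hx =>
    mul_nonneg (pow_nonneg hx.1 _) (one_sub_rpow_div_nonneg hs0 hx.1 hx.2)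

theorem rpowTail_le {s : ℝ} (hs0 : 0 ≤ s) (hs1 : s ≤ 1) (N : ℕ) :
    rpowTail s N ≤ 1 / ((N : ℝ) + 1) := by
  have : ∫ x in (0 : ℝ)..1, x ^ N = 1 / ((N : ℝ) + 1) := by
    rw [integral_pow]; simp
  rw [← this]
  refine intervalIntegral.integral_mono_on zero_le_one
    (intervalIntegrable_pow_mul_rpow_div hs0 hs1 N)
    (by apply Continuous.intervalIntegrable; fun_prop) fun x hx => ?_
  exact mul_le_of_le_one_right (pow_nonneg hx.1 _) (one_sub_rpow_div_le_one hs1 hx.1 hx.2)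

/-- The factor `1 - x` from `x^N - x^(N+1)` cancels the denominator; telescoping this identity
yields `shiftedSum_eq`. -/
theorem rpowTail_sub_succ {s : ℝ} (hs0 : 0 ≤ s) (hs1 : s ≤ 1) (N : ℕ) :
    rpowTail s N - rpowTail s (N + 1) = 1 / ((N : ℝ) + 1) - 1 / ((N : ℝ) + 1 + s) := by
  unfold rpowTail
  rw [← intervalIntegral.integral_sub (intervalIntegrable_pow_mul_rpow_div hs0 hs1 N)
    (intervalIntegrable_pow_mul_rpow_div hs0 hs1 (N + 1))]
  have h1 : ∫ x in (0 : ℝ)..1, (x ^ N * ((1 - x ^ s) / (1 - x)) -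
      x ^ (N + 1) * ((1 - x ^ s) / (1 - x))) = ∫ x in (0 : ℝ)..1, (x ^ N - x ^ ((N : ℝ) + s)) := by
    refine intervalIntegral.integral_congr_ae ?_
    have : ∀ᵐ x : ℝ, x ≠ 1 := by
      simp [MeasureTheory.ae_iff]
    filter_upwards [this] with x hx1 hx
    rw [Set.uIoc_of_le zero_le_one] at hx
    have : 1 - x ≠ 0 := sub_ne_zero.mpr (Ne.symm hx1)
    rw [Real.rpow_add hx.1, Real.rpow_natCast]
    field_simp
    ring
  rw [h1, intervalIntegral.integral_sub (by apply Continuous.intervalIntegrable; fun_prop)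
    (by apply intervalIntegral.intervalIntegrable_rpow'; have : (0 : ℝ) ≤ N := by positivity
        linarith), integral_pow, integral_rpow (by left; have : (0 : ℝ) ≤ N := by positivity
                                                   linarith)]
  have : (N : ℝ) + s + 1 ≠ 0 := by positivity
  rw [Real.one_rpow, Real.zero_rpow this]
  simp
  ring

/-- The finite sums `∑_{k=1}^N (1/k - 1/(k+s))`. -/
noncomputable def shiftedSum (s : ℝ) (N : ℕ) : ℝ :=
  ∑ k ∈ Finset.range N, (1 / ((k : ℝ) + 1) - 1 / ((k : ℝ) + 1 + s))

theorem shiftedSum_eq {s : ℝ} (hs0 : 0 ≤ s) (hs1 : s ≤ 1) (N : ℕ) :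
    shiftedSum s N = rpowTail s 0 - rpowTail s N := by
  unfold shiftedSum
  rw [← Finset.sum_range_sub']
  exact Finset.sum_congr rfl fun k _ => (rpowTail_sub_succ hs0 hs1 k).symm

theorem continuousOn_shiftedSum (N : ℕ) :
    ContinuousOn (fun s => shiftedSum s N) (Set.uIcc (0 : ℝ) 1) := by
  unfold shiftedSum
  refine continuousOn_finsetSum _ fun k _ => continuousOn_const.sub
    (continuousOn_const.div (by fun_prop) fun s hs => ?_)
  rw [Set.uIcc_of_le zero_le_one] at hs
  have := hs.1
  positivity

theorem eulerPartialSum_eq_sum_range (N : ℕ) : eulerPartialSum N =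
    ∑ k ∈ Finset.range N, (1 / ((k : ℝ) + 1) - Real.log (((k : ℝ) + 1 + 1) / ((k : ℝ) + 1))) := by
  unfold eulerPartialSum eulerPartialSumShift
  induction N with
  | zero => simp
  | succ N ih =>
    rw [Finset.sum_Icc_succ_top (by omega), ih, Finset.sum_range_succ]
    simp

theorem eulerPartialSum_eq_integral (N : ℕ) :
    eulerPartialSum N = ∫ s in (0 : ℝ)..1, shiftedSum s N := by
  have hc : ∀ k : ℕ, IntervalIntegrable (fun s : ℝ => 1 / ((k : ℝ) + 1 + s))
      MeasureTheory.volume 0 1 := by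
    intro k
    apply ContinuousOn.intervalIntegrable
    refine continuousOn_const.div (by fun_prop) fun s hs => ?_
    rw [Set.uIcc_of_le zero_le_one] at hs
    have := hs.1
    positivity
  rw [eulerPartialSum_eq_sum_range]
  unfold shiftedSum
  rw [intervalIntegral.integral_finsetSum fun k _ => intervalIntegrable_const.sub (hc k)]
  refine Finset.sum_congr rfl fun k _ => ?_
  rw [intervalIntegral.integral_sub intervalIntegrable_const (hc k)]
  have h := intervalIntegral.integral_eq_sub_of_hasDerivAt
    (f := fun s : ℝ => Real.log ((k : ℝ) + 1 + s)) (f' := fun s => 1 / ((k : ℝ) + 1 + s))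
    (fun s hs => by
      rw [Set.uIcc_of_le zero_le_one] at hs
      have := hs.1
      exact ((hasDerivAt_id s).const_add ((k : ℝ) + 1)).log (by simp only [id]; positivity))
    (hc k)
  rw [h, Real.log_div (by positivity) (by positivity)]
  simp

theorem eulerPartialSum_eq_eulerMascheroniSeq (N : ℕ) :
    eulerPartialSum N = Real.eulerMascheroniSeq N := by
  rw [eulerPartialSum_eq_sum_range]
  induction N with
  | zero => simp [Real.eulerMascheroniSeq_zero]
  | succ N ih =>
    rw [Finset.sum_range_succ, ih, Real.log_div (by positivity) (by positivity)]
    simp only [Real.eulerMascheroniSeq, harmonic_succ]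
    push_cast
    ring

theorem tendsto_eulerPartialSum :
    Filter.Tendsto eulerPartialSum Filter.atTop (nhds Real.eulerMascheroniConstant) := by
  rw [funext eulerPartialSum_eq_eulerMascheroniSeq]
  exact Real.tendsto_eulerMascheroniSeq

/-! ### Stieltjes representation of `(1 - x^s) / (1 - x)` -/

-- Subtract the integral representation of `x^s` from its value at `1`: the difference of the
-- integrands is `(1 - x) t^s/((t+1)(x+t))`.
open MeasureTheory in
theorem one_sub_rpow_div_eq_integral {s x : ℝ} (hs : s ∈ Set.Ioo (0 : ℝ) 1) (hx0 : 0 < x)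
    (hx1 : x ≠ 1) :
    (1 - x ^ s) / (1 - x) = (∫ t in Set.Ioi 0, Real.rpowIntegrand₀₁ s t 1)⁻¹ *
      ∫ t in Set.Ioi (0 : ℝ), t ^ s / ((t + 1) * (x + t)) := by
  set I := ∫ t in Set.Ioi 0, Real.rpowIntegrand₀₁ s t 1 with hI
  have hIpos : 0 < I := Real.integral_rpowIntegrand₀₁_one_pos hs
  have hx := Real.rpow_eq_const_mul_integral hs hx0.le
  have hsub : I - ∫ t in Set.Ioi 0, Real.rpowIntegrand₀₁ s t x =
      (1 - x) * ∫ t in Set.Ioi (0 : ℝ), t ^ s / ((t + 1) * (x + t)) := by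
    rw [hI, ← integral_sub (Real.integrableOn_rpowIntegrand₀₁_Ioi hs zero_le_one)
      (Real.integrableOn_rpowIntegrand₀₁_Ioi hs hx0.le), ← integral_const_mul]
    refine setIntegral_congr_fun measurableSet_Ioi fun t ht => ?_
    have ht0 : 0 < t := ht
    simp only [Real.rpowIntegrand₀₁]
    field_simp
    ring
  have hne : 1 - x ≠ 0 := sub_ne_zero.mpr (Ne.symm hx1)
  rw [hx, ← hI, div_eq_iff hne]
  have : I⁻¹ * I = 1 := inv_mul_cancel₀ hIpos.ne'
  linear_combination I⁻¹ * hsub - this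

open MeasureTheory in
theorem integral_mul_one_sub_rpow_div {s : ℝ} (hs : s ∈ Set.Ioo (0 : ℝ) 1) {W : ℝ → ℝ}
    (hW : Continuous W) :
    ∫ x in (0 : ℝ)..1, W x * ((1 - x ^ s) / (1 - x)) =
      (∫ t in Set.Ioi 0, Real.rpowIntegrand₀₁ s t 1)⁻¹ *
        ∫ t in Set.Ioi (0 : ℝ), t ^ s / (t + 1) *
          ∫ x in (0 : ℝ)..1, W x * stieltjesKernel 0 0 t x := by
  set I := ∫ t in Set.Ioi 0, Real.rpowIntegrand₀₁ s t 1 with hI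
  set F : ℝ → ℝ → ℝ := fun x t => W x * (t ^ s / ((t + 1) * (x + t))) with hF
  have h1 : ∫ x in (0 : ℝ)..1, W x * ((1 - x ^ s) / (1 - x)) =
      I⁻¹ * ∫ x in (0 : ℝ)..1, ∫ t in Set.Ioi (0 : ℝ), F x t := by
    rw [← intervalIntegral.integral_const_mul]
    refine intervalIntegral.integral_congr_ae ?_
    have : ∀ᵐ x : ℝ, x ≠ 1 := by
      simp [MeasureTheory.ae_iff]
    filter_upwards [this] with x hx1 hx
    rw [Set.uIoc_of_le zero_le_one] at hx
    rw [one_sub_rpow_div_eq_integral hs hx.1 hx1]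
    simp only [hF]
    rw [integral_const_mul]
    ring
  have hint : Integrable F.uncurry
      ((volume.restrict (Set.uIoc (0 : ℝ) 1)).prod (volume.restrict (Set.Ioi (0 : ℝ)))) := by
    -- Fubini holds because `1/((t+1)(x+t)) ≤ 1/((t+1)t)`, which makes the integrand at most a
    -- constant times `rpowIntegrand₀₁ s t 1`, free of `x`.
    obtain ⟨B, hB⟩ := (isCompact_Icc (a := (0 : ℝ)) (b := 1)).exists_bound_of_continuousOn
      hW.continuousOn
    have hg : Integrable (fun z : ℝ × ℝ => B * Real.rpowIntegrand₀₁ s z.2 1)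
        ((volume.restrict (Set.uIoc (0 : ℝ) 1)).prod (volume.restrict (Set.Ioi (0 : ℝ)))) := by
      have h0 : Integrable (fun t => Real.rpowIntegrand₀₁ s t 1)
        (volume.restrict (Set.Ioi (0 : ℝ))) :=
          Real.integrableOn_rpowIntegrand₀₁_Ioi hs zero_le_one
      have : IsFiniteMeasure (volume.restrict (Set.uIoc (0 : ℝ) 1)) := by
        rw [Set.uIoc_of_le zero_le_one]
        infer_instance
      exact (h0.comp_snd _).const_mul B
    refine hg.mono' (Measurable.aestronglyMeasurable ?_) ?_
    · have := hW.measurable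
      simp only [hF, Function.uncurry_def]
      fun_prop
    · rw [Measure.prod_restrict]
      refine ae_restrict_of_forall_mem (measurableSet_uIoc.prod measurableSet_Ioi) ?_
      rintro ⟨x, t⟩ ⟨hx, ht⟩
      rw [Set.uIoc_of_le zero_le_one] at hx
      have ht0 : 0 < t := ht
      have hx0 : 0 < x := hx.1
      have hWx := hB x ⟨hx0.le, hx.2⟩
      have hts : 0 < t ^ s := Real.rpow_pos_of_pos ht0 s
      simp only [hF, Function.uncurry_apply_pair, norm_mul, Real.rpowIntegrand₀₁]
      rw [Real.norm_eq_abs (t ^ s / _), abs_of_pos (by positivity)]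
      refine mul_le_mul hWx ?_ (by positivity) ((norm_nonneg _).trans hWx)
      have : t ^ s * (t⁻¹ - (t + 1)⁻¹) = t ^ s / ((t + 1) * t) := by field_simp; ring
      rw [this]
      gcongr
      linarith
  rw [h1, intervalIntegral_integral_swap hint]
  congr 1
  refine setIntegral_congr_fun measurableSet_Ioi fun t ht => ?_
  rw [← intervalIntegral.integral_const_mul]
  refine intervalIntegral.integral_congr fun x hx => ?_
  rw [Set.uIcc_of_le zero_le_one] at hx
  have ht0 : 0 < t := ht
  have := hx.1
  have : x + t ≠ 0 := by positivity
  simp only [hF, stieltjesKernel]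
  field_simp
  ring

/-! ### From kernel bounds to Euler's constant -/

theorem MomentBound.nonneg {L r q : ℕ} {A : Polynomial ℝ} {e d : ℕ} {C : ℝ}
    (h : MomentBound L r q A e d C) : 0 ≤ C := by
  simpa using (abs_nonneg _).trans (h 1 one_pos)

-- No constant is lost: `C/t` integrated against `t^s/(t+1)` gives `C` times exactly the normalising
-- integral of the mixture.
open MeasureTheory in
theorem MomentBound.abs_altSum_rpowTail_le {L r q : ℕ} {A : Polynomial ℝ} {C : ℝ}
    (h : MomentBound L r q A 0 0 C) {s : ℝ} (hs : s ∈ Set.Ioo (0 : ℝ) 1) :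
    |altSum L fun k => A.eval (k : ℝ) * rpowTail s (r * k + q)| ≤ C := by
  have hI := Real.integral_rpowIntegrand₀₁_one_pos hs
  unfold rpowTail
  rw [altSum_mul_integral L r q A (intervalIntegrable_pow_mul_rpow_div hs.1.le hs.2.le),
    integral_mul_one_sub_rpow_div hs (continuous_weightFun L r q A), abs_mul,
    abs_of_pos (inv_pos.mpr hI), inv_mul_le_iff₀ hI, ← Real.norm_eq_abs, ← integral_mul_const]
  refine norm_integral_le_of_norm_le
    ((Real.integrableOn_rpowIntegrand₀₁_Ioi hs zero_le_one).mul_const C)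
    (ae_restrict_of_forall_mem measurableSet_Ioi fun t ht => ?_)
  have ht0 : 0 < t := ht
  have hts : 0 < t ^ s := Real.rpow_pos_of_pos ht0 s
  rw [← weightedMoment_eq_integral _ _ _ _ _ _ ht0, Real.norm_eq_abs, abs_mul,
    abs_of_pos (by positivity)]
  calc t ^ s / (t + 1) * |weightedMoment L r q A 0 0 t| ≤ t ^ s / (t + 1) * (C / t) :=
        mul_le_mul_of_nonneg_left (h t ht0) (by positivity)
    _ = _ := by
      simp only [Real.rpowIntegrand₀₁]
      field_simp
      ring

theorem altSum_integral {L : ℕ} {f : ℕ → ℝ → ℝ} {a b : ℝ}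
    (hf : ∀ k, IntervalIntegrable (f k) MeasureTheory.volume a b) :
    (altSum L fun k => ∫ s in a..b, f k s) = ∫ s in a..b, altSum L fun k => f k s := by
  unfold altSum
  rw [intervalIntegral.integral_finsetSum fun k _ => (hf k).const_mul _]
  simp only [intervalIntegral.integral_const_mul]

/-- With `S_K` in place of `γ`, only finite sums are integrated in `s`; the last term tends to zero
as `K → ∞`. -/
theorem MomentBound.abs_altSum_eulerPartialSum_le {L r q : ℕ} {A : Polynomial ℝ} {C : ℝ}
    (h : MomentBound L r q A 0 0 C) (K : ℕ) :
    |altSum L fun k => A.eval (k : ℝ) * (eulerPartialSum K - eulerPartialSum (r * k + q))| ≤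
      C + |altSum L fun k => A.eval (k : ℝ)| * (1 / ((K : ℝ) + 1)) := by
  have hi : ∀ N, IntervalIntegrable (fun s => shiftedSum s N) MeasureTheory.volume 0 1 :=
    fun N => (continuousOn_shiftedSum N).intervalIntegrable
  have h1 : ∀ k : ℕ, A.eval (k : ℝ) * (eulerPartialSum K - eulerPartialSum (r * k + q)) =
      ∫ s in (0 : ℝ)..1, A.eval (k : ℝ) * (shiftedSum s K - shiftedSum s (r * k + q)) := by
    intro k
    rw [intervalIntegral.integral_const_mul, intervalIntegral.integral_sub (hi _) (hi _),
      eulerPartialSum_eq_integral, eulerPartialSum_eq_integral]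
  rw [altSum_congr h1, altSum_integral fun k => ((hi _).sub (hi _)).const_mul _]
  have hb : ∀ᵐ s : ℝ, s ∈ Set.uIoc (0 : ℝ) 1 →
      ‖altSum L fun k => A.eval (k : ℝ) * (shiftedSum s K - shiftedSum s (r * k + q))‖ ≤
      C + |altSum L fun k => A.eval (k : ℝ)| * (1 / ((K : ℝ) + 1)) := by
    have : ∀ᵐ s : ℝ, s ≠ 1 := by
      simp [MeasureTheory.ae_iff]
    filter_upwards [this] with s hs1 hs
    rw [Set.uIoc_of_le zero_le_one] at hs
    have hs' : s ∈ Set.Ioo (0 : ℝ) 1 := ⟨hs.1, lt_of_le_of_ne hs.2 hs1⟩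
    have h2 : ∀ k : ℕ, A.eval (k : ℝ) * (shiftedSum s K - shiftedSum s (r * k + q)) =
        A.eval (k : ℝ) * rpowTail s (r * k + q) - A.eval (k : ℝ) * rpowTail s K := by
      intro k
      rw [shiftedSum_eq hs.1.le hs.2, shiftedSum_eq hs.1.le hs.2]
      ring
    rw [altSum_congr h2, altSum_sub, altSum_mul_const, Real.norm_eq_abs]
    refine (abs_sub _ _).trans (add_le_add (h.abs_altSum_rpowTail_le hs') ?_)
    rw [abs_mul, abs_of_nonneg (rpowTail_nonneg hs.1.le K)]
    exact mul_le_mul_of_nonneg_left (rpowTail_le hs.1.le hs.2 K) (abs_nonneg _)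
  simpa using intervalIntegral.norm_integral_le_of_norm_le_const_ae hb

theorem MomentBound.abs_altSum_eulerMascheroniConstant_le {L r q : ℕ} {A : Polynomial ℝ} {C : ℝ}
    (h : MomentBound L r q A 0 0 C) :
    |altSum L fun k => A.eval (k : ℝ) *
      (Real.eulerMascheroniConstant - eulerPartialSum (r * k + q))| ≤ C := by
  have hl : Filter.Tendsto (fun K : ℕ => |altSum L fun k => A.eval (k : ℝ) *
      (eulerPartialSum K - eulerPartialSum (r * k + q))|) Filter.atTop
      (nhds |altSum L fun k => A.eval (k : ℝ) *
        (Real.eulerMascheroniConstant - eulerPartialSum (r * k + q))|) := by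
    unfold altSum
    exact (tendsto_finsetSum _ fun k _ => (((tendsto_eulerPartialSum.sub_const _).const_mul
      _).const_mul _)).abs
  have hr : Filter.Tendsto (fun K : ℕ => C + |altSum L fun k => A.eval (k : ℝ)| *
      (1 / ((K : ℝ) + 1))) Filter.atTop (nhds C) := by
    simpa using (tendsto_one_div_add_atTop_nhds_zero_nat.const_mul
      |altSum L fun k => A.eval (k : ℝ)|).const_add C
  exact le_of_tendsto_of_tendsto' hl hr fun K => h.abs_altSum_eulerPartialSum_le K

/-! ### The bound for the constant polynomial -/

theorem weightFun_one (L r q : ℕ) (x : ℝ) : weightFun L r q 1 x = x ^ q * (1 - x ^ r) ^ L := by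
  unfold weightFun altSum
  rw [sub_eq_neg_add, add_pow, Finset.mul_sum]
  refine Finset.sum_congr rfl fun k _ => ?_
  simp only [Polynomial.eval_one]
  rw [neg_pow, pow_add, pow_mul, one_pow]
  ring

/-- After multiplication by `t`, the kernel is a product of `e` factors `xt/(x+t)² ≤ 1/4` and
`d+1-e` factors `t/(x+t) ≤ 1`. -/
theorem stieltjesKernel_le {e d : ℕ} (hed : e ≤ d + 1) {t x : ℝ} (ht : 0 < t) (hx : 0 ≤ x) :
    stieltjesKernel e d t x ≤ (1 / 4) ^ e / t := by
  obtain ⟨j, hj⟩ := Nat.exists_eq_add_of_le hed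
  have hxt : 0 < x + t := by positivity
  have h1 : x * t / (x + t) ^ 2 ≤ 1 / 4 := by
    rw [div_le_div_iff₀ (by positivity) (by norm_num)]
    nlinarith [sq_nonneg (x - t)]
  have h2 : t / (x + t) ≤ 1 := div_le_one_of_le₀ (by linarith) hxt.le
  have h3 : stieltjesKernel e d t x * t = (x * t / (x + t) ^ 2) ^ e * (t / (x + t)) ^ j := by
    unfold stieltjesKernel
    rw [div_mul_eq_mul_div, mul_assoc, ← pow_succ, hj, show e + d + 1 = e + (d + 1) by ring, hj,
      div_pow, div_pow, ← pow_mul, div_mul_div_comm, ← pow_add, mul_pow, pow_add,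
      show e + (e + j) = 2 * e + j by ring]
    ring
  rw [le_div_iff₀ ht, h3]
  calc _ ≤ (1 / 4 : ℝ) ^ e * 1 := by
        gcongr
        exact pow_le_one₀ (by positivity) h2
    _ = _ := mul_one _

theorem momentBound_one {L r q e d m : ℕ} (hed : e ≤ d + 1) {G : ℝ}
    (hG : ∀ x : ℝ, 0 ≤ x → x ≤ 1 → x ^ q * (1 - x ^ r) ^ L ≤ G * x ^ m) :
    MomentBound L r q 1 e d ((1 / 4) ^ e * (G / (m + 1))) := by
  intro t ht
  rw [weightedMoment_eq_integral _ _ _ _ _ _ ht, ← Real.norm_eq_abs]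
  have h : ∫ x in (0 : ℝ)..1, G * x ^ m * ((1 / 4) ^ e / t) =
      (1 / 4) ^ e * (G / (m + 1)) / t := by
    rw [intervalIntegral.integral_mul_const, intervalIntegral.integral_const_mul, integral_pow]
    simp
    ring
  rw [← h]
  refine intervalIntegral.norm_integral_le_of_norm_le zero_le_one
    (Filter.Eventually.of_forall fun x hx => ?_)
    (by apply Continuous.intervalIntegrable; fun_prop)
  have hx0 : 0 < x := hx.1
  have hK : 0 ≤ stieltjesKernel e d t x := by unfold stieltjesKernel; positivity
  have hW : 0 ≤ x ^ q * (1 - x ^ r) ^ L :=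
    mul_nonneg (by positivity) (pow_nonneg (sub_nonneg.mpr (pow_le_one₀ hx0.le hx.2)) _)
  rw [weightFun_one, Real.norm_eq_abs, abs_of_nonneg (mul_nonneg hW hK)]
  exact mul_le_mul (hG x hx0.le hx.2) (stieltjesKernel_le hed ht hx0.le) hK
    (hW.trans (hG x hx0.le hx.2))

/-! ### Block structure of the binomial product -/

/-- The polynomial `∏_{i<a} (r X + j (a + 1) - i)`. -/
noncomputable def blockPoly (r a j : ℕ) : Polynomial ℝ :=
  ∏ i ∈ Finset.range a, linPoly r ((j : ℝ) * (a + 1) - i)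

theorem natDegree_linPoly {r : ℕ} (hr : 1 ≤ r) (b : ℝ) : (linPoly r b).natDegree = 1 :=
  Polynomial.natDegree_linear (by positivity)

theorem leadingCoeff_linPoly {r : ℕ} (hr : 1 ≤ r) (b : ℝ) : (linPoly r b).leadingCoeff = r :=
  Polynomial.leadingCoeff_linear (by positivity)

theorem linPoly_ne_zero {r : ℕ} (hr : 1 ≤ r) (b : ℝ) : linPoly r b ≠ 0 :=
  Polynomial.ne_zero_of_natDegree_gt (n := 0) (by rw [natDegree_linPoly hr]; exact one_pos)

theorem blockPoly_ne_zero {r : ℕ} (hr : 1 ≤ r) (a j : ℕ) : blockPoly r a j ≠ 0 :=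
  Finset.prod_ne_zero_iff.mpr fun _ _ => linPoly_ne_zero hr _

theorem natDegree_blockPoly {r : ℕ} (hr : 1 ≤ r) (a j : ℕ) : (blockPoly r a j).natDegree = a := by
  unfold blockPoly
  rw [Polynomial.natDegree_prod _ _ fun _ _ => linPoly_ne_zero hr _]
  simp [natDegree_linPoly hr]

theorem leadingCoeff_blockPoly {r : ℕ} (hr : 1 ≤ r) (a j : ℕ) :
    (blockPoly r a j).leadingCoeff = (r : ℝ) ^ a := by
  unfold blockPoly
  rw [Polynomial.leadingCoeff_prod]
  simp [leadingCoeff_linPoly hr]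

theorem eval_blockPoly (r a : ℕ) {j : ℕ} (hj : 1 ≤ j) (k : ℕ) :
    (blockPoly r a j).eval (k : ℝ) = (a.factorial : ℝ) * ((r * k + j * a + j).choose a : ℝ) := by
  rw [← Nat.cast_mul, ← Nat.descFactorial_eq_factorial_mul_choose, Nat.descFactorial_eq_prod_range,
    blockPoly, Polynomial.eval_prod, Nat.cast_prod]
  refine Finset.prod_congr rfl fun i hi => ?_
  have hi' := Finset.mem_range.mp hi
  have : i ≤ r * k + j * a + j := by nlinarith
  rw [eval_linPoly, Nat.cast_sub this]
  push_cast
  ring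

/-- The product of the first `j` blocks. -/
noncomputable def blockProd (r a j : ℕ) : Polynomial ℝ :=
  ∏ l ∈ Finset.range j, blockPoly r a (l + 1)

theorem natDegree_blockProd {r : ℕ} (hr : 1 ≤ r) (a j : ℕ) :
    (blockProd r a j).natDegree = j * a := by
  unfold blockProd
  rw [Polynomial.natDegree_prod _ _ fun _ _ => blockPoly_ne_zero hr _ _]
  simp [natDegree_blockPoly hr]

theorem leadingCoeff_blockProd {r : ℕ} (hr : 1 ≤ r) (a j : ℕ) :
    (blockProd r a j).leadingCoeff = (r : ℝ) ^ (j * a) := by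
  unfold blockProd
  rw [Polynomial.leadingCoeff_prod]
  simp [leadingCoeff_blockPoly hr, ← pow_mul, mul_comm]

theorem eval_blockProd (r a m k : ℕ) : (blockProd r a m).eval (k : ℝ) =
    (a.factorial : ℝ) ^ m * ∏ j ∈ Finset.Icc 1 m, ((r * k + j * a + j).choose a : ℝ) := by
  unfold blockProd
  induction m with
  | zero => simp
  | succ m ih =>
    rw [Finset.prod_range_succ, Polynomial.eval_mul, ih, Finset.prod_Icc_succ_top (by omega),
      eval_blockPoly r a (by omega)]
    ring

theorem altSum_eval_blockProd {r : ℕ} (hr : 1 ≤ r) (h m : ℕ) :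
    (altSum (m * (2 * h)) fun k => (blockProd r (2 * h) m).eval (k : ℝ)) =
      ((m * (2 * h)).factorial : ℝ) * (r : ℝ) ^ (m * (2 * h)) := by
  have := altSum_eval_natDegree (blockProd r (2 * h) m)
  rw [natDegree_blockProd hr, leadingCoeff_blockProd hr] at this
  rw [this, Even.neg_one_pow (by simp)]
  ring

/-- The factor gained by passing one block at level `l`. -/
noncomputable def blockConst (h l : ℕ) : ℝ :=
  (∏ i ∈ Finset.range (2 * h), ((l : ℝ) * (2 * h + 1) + i + 1)) *
    ((l : ℝ) * (2 * h + 1) / ((l : ℝ) * (2 * h + 1) - h))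

/-- Each block takes `2h` right raises, then one skip over the missing offset, so `d` drops by `2h +
1` per block. -/
theorem momentBound_blockProd {r h m : ℕ} (hr : 1 ≤ r) (hh : 1 ≤ h) {C : ℝ} (j : ℕ) (hj : j < m)
    (h0 : MomentBound (m * (2 * h)) r (m * (2 * h + 1) - h) 1 h (m * (2 * h + 1) - h - 1) C) :
    MomentBound (m * (2 * h)) r (m * (2 * h + 1) - h) (blockProd r (2 * h) j) h
      ((m - j) * (2 * h + 1) - h - 1)
      ((∏ i ∈ Finset.range j, blockConst h (m - 1 - i)) * C) := by
  induction j with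
  | zero => simpa [blockProd] using h0
  | succ j ih =>
    have ih := ih (by omega)
    obtain ⟨l, rfl⟩ : ∃ l, m = j + 1 + (l + 1) := ⟨m - j - 2, by omega⟩
    have e1 : (j + 1 + (l + 1) - j) * (2 * h + 1) - h - 1 =
        ((l + 1) * (2 * h + 1) - h) + 2 * h := by
      rw [show j + 1 + (l + 1) - j = l + 2 by omega, show (l + 2) * (2 * h + 1) =
        (l + 1) * (2 * h + 1) + (2 * h + 1) by ring, Nat.add_mul l 1]
      omega
    have e2 : (j + 1 + (l + 1) - (j + 1)) = l + 1 := by omega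
    have e3 : j + 1 + (l + 1) - 1 - j = l + 1 := by omega
    have hle : h + 1 ≤ (l + 1) * (2 * h + 1) := by nlinarith
    have hle2 : h ≤ (j + 1 + (l + 1)) * (2 * h + 1) := by nlinarith
    rw [e1] at ih
    have hdeg : (blockProd r (2 * h) j).natDegree + 2 * h ≤ (j + 1 + (l + 1)) * (2 * h) := by
      rw [natDegree_blockProd hr]
      nlinarith
    have h1 := MomentBound.raise_right_iterate (2 * h) hdeg ih
    obtain ⟨d, hd⟩ : ∃ d, (l + 1) * (2 * h + 1) - h = d + 1 :=
      ⟨(l + 1) * (2 * h + 1) - h - 1, by omega⟩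
    have hdR : (d : ℝ) + 1 = (l + 1) * (2 * h + 1) - h := by
      have : ((l + 1) * (2 * h + 1) : ℕ) = d + 1 + h := by omega
      have := congrArg (Nat.cast (R := ℝ)) this
      push_cast at this
      linarith
    have hd1 : 1 ≤ d := by
      have : 2 * h + 1 ≤ (l + 1) * (2 * h + 1) := by nlinarith
      omega
    rw [hd] at h1
    have h2 := MomentBound.skip hd1 h1
    rw [e2, hd, Nat.add_sub_cancel, Finset.prod_range_succ, e3]
    have hpoly : blockProd r (2 * h) (j + 1) = blockProd r (2 * h) j *
        ∏ i ∈ Finset.range (2 * h), linPoly r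
          ((((j + 1 + (l + 1)) * (2 * h + 1) - h : ℕ) : ℝ) - (((d + 1 : ℕ) : ℝ) + i)) := by
      rw [blockProd, Finset.prod_range_succ, ← blockProd, blockPoly]
      congr 1
      refine Finset.prod_congr rfl fun i _ => ?_
      congr 1
      rw [Nat.cast_sub hle2]
      push_cast
      linear_combination hdR
    rw [hpoly]
    convert h2 using 1
    rw [blockConst, hdR, show (h : ℝ) + d + 1 = (l + 1) * (2 * h + 1) by linear_combination hdR]
    push_cast
    rw [show ∀ i : ℕ → ℝ, (∏ k ∈ Finset.range (2 * h), ((h : ℝ) + ((d : ℝ) + 1 + (k : ℝ)) + 1)) =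
      ∏ k ∈ Finset.range (2 * h), (((l : ℝ) + 1) * (2 * h + 1) + (k : ℝ) + 1) from fun _ =>
        Finset.prod_congr rfl fun k _ => by linear_combination hdR]
    · ring
    -- Fills the dummy function argument of the identity just used for rewriting.
    · exact fun _ => 0

/-- Splits a block about its centre `b`. For the top block `b = q`, and the two halves are the
factors obtained by lowering `d` and `e` from `h` to `0`. -/
theorem blockPoly_eq_mul (r h j : ℕ) (b : ℝ) (hb : b = (j : ℝ) * (2 * h + 1) - h) :
    blockPoly r (2 * h) j = (∏ i ∈ Finset.range h, linPoly r (b - i)) *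
      ∏ i ∈ Finset.range h, linPoly r (b + 1 + i) := by
  rw [blockPoly, two_mul, Finset.prod_range_add, mul_comm]
  congr 1
  · refine Finset.prod_congr rfl fun i _ => ?_
    congr 1
    rw [hb]
    push_cast
    ring
  · rw [← Finset.prod_range_reflect]
    refine Finset.prod_congr rfl fun i hi => ?_
    have : i + 1 ≤ h := Finset.mem_range.mp hi
    congr 1
    rw [hb, show h - 1 - i = h - (i + 1) by omega, Nat.cast_sub this]
    push_cast
    ring

theorem momentBound_full {r h m : ℕ} (hr : 1 ≤ r) (hh : 1 ≤ h) (hm : 1 ≤ m) {C : ℝ}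
    (h0 : MomentBound (m * (2 * h)) r (m * (2 * h + 1) - h) 1 h (m * (2 * h + 1) - h - 1) C) :
    MomentBound (m * (2 * h)) r (m * (2 * h + 1) - h) (blockProd r (2 * h) m) 0 0
      (((2 * h).factorial * ∏ l ∈ Finset.range (m - 1), blockConst h (l + 1)) * C) := by
  obtain ⟨m, rfl⟩ : ∃ j, m = j + 1 := ⟨m - 1, by omega⟩
  have h1 := momentBound_blockProd hr hh m (Nat.lt_succ_self m) h0
  have e1 : (m + 1 - m) * (2 * h + 1) - h - 1 = 0 + h := by
    rw [Nat.add_sub_cancel_left]; omega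
  rw [e1] at h1
  have hle : h ≤ (m + 1) * (2 * h + 1) := by nlinarith
  have h2 := MomentBound.raise_right_iterate h (by rw [natDegree_blockProd hr]; nlinarith) h1
  have hd2 : ((∏ i ∈ Finset.range h, linPoly r ((((m + 1) * (2 * h + 1) - h : ℕ) : ℝ) -
      (((0 : ℕ) : ℝ) + i)))).natDegree ≤ h := by
    refine (Polynomial.natDegree_prod_le _ _).trans ?_
    simp [natDegree_linPoly hr]
  rw [← Nat.zero_add h] at h2
  have h3 := MomentBound.raise_left_iterate (e := 0) h (by
    refine (Nat.add_le_add_right Polynomial.natDegree_mul_le _).trans ?_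
    rw [natDegree_blockProd hr]
    simp only [Nat.zero_add] at *
    nlinarith) h2
  simp only [Nat.zero_add] at h3
  have hpoly := blockPoly_eq_mul r h (m + 1) (((m + 1) * (2 * h + 1) - h : ℕ) : ℝ) (by
    rw [Nat.cast_sub hle]; push_cast; ring)
  rw [blockProd, Finset.prod_range_succ, ← blockProd, hpoly]
  have hfac : ((2 * h).factorial : ℝ) = (∏ i ∈ Finset.range h, ((h : ℝ) + i + 1)) *
      ∏ i ∈ Finset.range h, ((i : ℝ) + 1) := by
    rw [← Finset.prod_range_add_one_eq_factorial, two_mul, Finset.prod_range_add, mul_comm]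
    push_cast
    rfl
  have href : ∏ i ∈ Finset.range m, blockConst h (m + 1 - 1 - i) =
      ∏ l ∈ Finset.range m, blockConst h (l + 1) := by
    rw [← Finset.prod_range_reflect]
    refine Finset.prod_congr rfl fun i hi => ?_
    have := Finset.mem_range.mp hi
    congr 1
    omega
  rw [href] at h3
  rw [Nat.add_sub_cancel, hfac]
  convert h3 using 1
  · simp [mul_assoc]
  · simp
    ring

/-! ### Estimating the accumulated constants -/

theorem factorial_mul_prod_range (n a : ℕ) :
    (n.factorial : ℝ) * ∏ i ∈ Finset.range a, ((n : ℝ) + i + 1) = ((n + a).factorial : ℝ) := by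
  induction a with
  | zero => simp
  | succ a ih =>
    rw [Finset.prod_range_succ, ← mul_assoc, ih, ← Nat.add_assoc, Nat.factorial_succ]
    push_cast
    ring

theorem blockConst_nonneg (h l : ℕ) (hl : 1 ≤ l) : 0 ≤ blockConst h l := by
  have hl' : (1 : ℝ) ≤ l := by exact_mod_cast hl
  have hh : (0 : ℝ) ≤ h := by positivity
  have : 0 ≤ (l : ℝ) * (2 * h + 1) - h := by nlinarith
  unfold blockConst
  positivity

/-- The cost of a skip is relaxed to `(l+1)/l`, so that the product of the costs telescopes. -/
theorem blockConst_le {h l : ℕ} (hl : 1 ≤ l) : blockConst h l ≤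
    (∏ i ∈ Finset.range (2 * h), ((l : ℝ) * (2 * h + 1) + i + 1)) * (((l : ℝ) + 1) / l) := by
  have hl' : (1 : ℝ) ≤ l := by exact_mod_cast hl
  have hh : (0 : ℝ) ≤ h := by positivity
  unfold blockConst
  refine mul_le_mul_of_nonneg_left ?_ (by positivity)
  rw [div_le_div_iff₀ (by nlinarith) (by linarith)]
  nlinarith

/-- The blocks run over all integers up to `(M+1)(2h) + M` except the multiples `l(2h+1)`, `1 ≤ l ≤
M`, whose product is the denominator. -/
theorem factorial_mul_prod_blockConst_le (h M : ℕ) :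
    ((2 * h).factorial : ℝ) * ∏ l ∈ Finset.range M, blockConst h (l + 1) ≤
      ((M : ℝ) + 1) * ((((M + 1) * (2 * h) + M).factorial : ℝ) /
        ((M.factorial : ℝ) * (2 * (h : ℝ) + 1) ^ M)) := by
  induction M with
  | zero => simp
  | succ M ih =>
    rw [Finset.prod_range_succ, ← mul_assoc]
    have hc := blockConst_le (h := h) (l := M + 1) (by omega)
    refine (mul_le_mul ih hc (blockConst_nonneg h _ (by omega)) (by positivity)).trans
      (le_of_eq ?_)
    have hf := factorial_mul_prod_range ((M + 1) * (2 * h) + M + 1) (2 * h)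
    rw [Nat.factorial_succ, show (M + 1) * (2 * h) + M + 1 + 2 * h =
      (M + 1 + 1) * (2 * h) + (M + 1) by ring] at hf
    rw [← hf, Nat.factorial_succ M]
    have hp : ∏ i ∈ Finset.range (2 * h), (((M + 1 : ℕ) : ℝ) * (2 * h + 1) + i + 1) =
        ∏ i ∈ Finset.range (2 * h), ((((M + 1) * (2 * h) + M + 1 : ℕ) : ℝ) + i + 1) :=
      Finset.prod_congr rfl fun i _ => by push_cast; ring
    rw [hp]
    push_cast
    field_simp
    ring

theorem factorial_add_le (n k b : ℕ) (hb : n + k ≤ b) :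
    ((n + k).factorial : ℝ) ≤ (n.factorial : ℝ) * (b : ℝ) ^ k := by
  rw [← factorial_mul_prod_range]
  refine mul_le_mul_of_nonneg_left ?_ (by positivity)
  calc ∏ i ∈ Finset.range k, ((n : ℝ) + i + 1) ≤ ∏ _i ∈ Finset.range k, (b : ℝ) := by
        refine Finset.prod_le_prod (fun i _ => by positivity) fun i hi => ?_
        have : n + i + 1 ≤ b := by have := Finset.mem_range.mp hi; omega
        exact_mod_cast this
    _ = (b : ℝ) ^ k := by simp

theorem factorial_mul_prod_blockConst_le_pow_div (h : ℕ) {m : ℕ} (hm : 1 ≤ m) :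
    ((2 * h).factorial : ℝ) * ∏ l ∈ Finset.range (m - 1), blockConst h (l + 1) ≤
      ((m * (2 * h)).factorial : ℝ) * ((m : ℝ) ^ m / ((m - 1).factorial : ℝ)) := by
  obtain ⟨M, rfl⟩ : ∃ j, m = j + 1 := ⟨m - 1, by omega⟩
  rw [Nat.add_sub_cancel]
  refine (factorial_mul_prod_blockConst_le h M).trans ?_
  have hf := factorial_add_le ((M + 1) * (2 * h)) M ((M + 1) * (2 * h + 1)) (by
    rw [Nat.mul_add]; omega)
  calc _ ≤ ((M : ℝ) + 1) * ((((M + 1) * (2 * h)).factorial * (((M + 1) * (2 * h + 1) : ℕ) : ℝ) ^ M)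
          / ((M.factorial : ℝ) * (2 * (h : ℝ) + 1) ^ M)) := by gcongr
    _ = _ := by
      push_cast
      rw [mul_pow]
      field_simp
      ring

/-! ### Maximum of the weight -/

/-- Weighted AM-GM for `y` and `1 - y`, each divided by its weight, so that the arithmetic mean is
`1`. -/
theorem rpow_mul_one_sub_rpow_le {y p β : ℝ} (hy0 : 0 ≤ y) (hy1 : y ≤ 1) (hp : 0 < p)
    (hβ : 0 < β) :
    y ^ p * (1 - y) ^ β ≤ (p / (p + β)) ^ p * (β / (p + β)) ^ β := by
  have hs : 0 < p + β := by positivity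
  have hw1 : 0 < p / (p + β) := by positivity
  have hw2 : 0 < β / (p + β) := by positivity
  have h1y : 0 ≤ 1 - y := sub_nonneg.mpr hy1
  have hu : 0 ≤ y / (p / (p + β)) := by positivity
  have hv : 0 ≤ (1 - y) / (β / (p + β)) := by positivity
  have hag := Real.geom_mean_le_arith_mean2_weighted hw1.le hw2.le hu hv (by field_simp)
  rw [mul_div_cancel₀ _ hw1.ne', mul_div_cancel₀ _ hw2.ne', add_sub_cancel] at hag
  have h := Real.rpow_le_rpow (by positivity) hag hs.le
  rw [Real.one_rpow, Real.mul_rpow (by positivity) (by positivity), ← Real.rpow_mul hu,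
    ← Real.rpow_mul hv, div_mul_cancel₀ _ hs.ne', div_mul_cancel₀ _ hs.ne',
    Real.div_rpow hy0 hw1.le, Real.div_rpow h1y hw2.le, div_mul_div_comm,
    div_le_one (by positivity)] at h
  exact h

theorem pow_mul_one_sub_pow_le {r α β : ℕ} (hr : 1 ≤ r) (hα : 1 ≤ α) (hβ : 1 ≤ β) {δ x : ℝ}
    (hδ : 0 < δ) (hαβ : (α : ℝ) = δ * β) (hx0 : 0 ≤ x) (hx1 : x ≤ 1) :
    x ^ α * (1 - x ^ r) ^ β ≤
      (r : ℝ) ^ β * (δ ^ ((α : ℝ) / r) / (r + δ) ^ ((β : ℝ) + (α : ℝ) / r)) := by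
  have hr0 : (0 : ℝ) < r := by positivity
  have hβ0 : (0 : ℝ) < β := by positivity
  have hp : (0 : ℝ) < (α : ℝ) / r := by positivity
  have h := rpow_mul_one_sub_rpow_le (pow_nonneg hx0 r) (pow_le_one₀ hx0 hx1) hp hβ0
  have hx : (x ^ r) ^ ((α : ℝ) / r) = x ^ α := by
    rw [← Real.rpow_natCast x r, ← Real.rpow_mul hx0, mul_div_cancel₀ _ hr0.ne',
      Real.rpow_natCast]
  have e1 : (α : ℝ) / r / ((α : ℝ) / r + β) = δ / (r + δ) := by
    rw [hαβ]
    field_simp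
    ring
  have e2 : (β : ℝ) / ((α : ℝ) / r + β) = r / (r + δ) := by
    rw [hαβ]
    field_simp
    ring
  rw [hx, Real.rpow_natCast, e1, e2, Real.div_rpow hδ.le (by positivity), Real.rpow_natCast,
    div_pow] at h
  rw [Real.rpow_add (by positivity), Real.rpow_natCast]
  refine h.trans (le_of_eq ?_)
  field_simp

/-! ### Assembly -/

theorem abs_eulerMascheroniConstant_sub_le {r h m : ℕ} (hr : 1 ≤ r) (hh : 1 ≤ h) (hm : 1 ≤ m)
    {G : ℝ} (hG : ∀ x : ℝ, 0 ≤ x → x ≤ 1 →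
      x ^ ((2 * m - 1) * h) * (1 - x ^ r) ^ (m * (2 * h)) ≤ (r : ℝ) ^ (m * (2 * h)) * G) :
    |Real.eulerMascheroniConstant -
      (((2 * h).factorial : ℝ) ^ m /
          (((m * (2 * h)).factorial : ℝ) * (r : ℝ) ^ (m * (2 * h)))) *
        altSum (m * (2 * h)) fun k =>
          (∏ j ∈ Finset.Icc 1 m, ((r * k + j * (2 * h) + j).choose (2 * h) : ℝ)) *
            eulerPartialSum (r * k + (m * (2 * h + 1) - h))| ≤
      (m : ℝ) ^ m / ((m - 1).factorial : ℝ) * ((1 / 4) ^ h * (G / (m + 1))) := by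
  have hq : (2 * m - 1) * h + m = m * (2 * h + 1) - h := by
    obtain ⟨M, rfl⟩ : ∃ j, m = j + 1 := ⟨m - 1, by omega⟩
    rw [show 2 * (M + 1) - 1 = 2 * M + 1 by omega]
    apply Nat.eq_sub_of_add_eq
    ring
  have hr0 : (0 : ℝ) < (r : ℝ) ^ (m * (2 * h)) := by positivity
  have hm1 : 2 * h + 1 ≤ m * (2 * h + 1) := by nlinarith
  -- Since `q = (2m-1)h + m`, the power `x^m` is kept out of the supremum; its integral supplies the
  -- `1/(m+1)`.
  have hb := momentBound_full hr hh hm (momentBound_one (m := m)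
    (G := (r : ℝ) ^ (m * (2 * h)) * G) (by omega) fun x hx0 hx1 => by
      rw [← hq, pow_add]
      have := mul_le_mul_of_nonneg_right (hG x hx0 hx1) (pow_nonneg hx0 m)
      linarith)
  have hnn := (momentBound_one (L := m * (2 * h)) (r := r) (q := m * (2 * h + 1) - h) (e := h)
    (d := m * (2 * h + 1) - h - 1) (m := m)
    (G := (r : ℝ) ^ (m * (2 * h)) * G) (by omega) fun x hx0 hx1 => by
      rw [← hq, pow_add]
      have := mul_le_mul_of_nonneg_right (hG x hx0 hx1) (pow_nonneg hx0 m)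
      linarith).nonneg
  have hle := hb.abs_altSum_eulerMascheroniConstant_le.trans
    (mul_le_mul_of_nonneg_right (factorial_mul_prod_blockConst_le_pow_div h hm) hnn)
  have hone := altSum_eval_blockProd hr h m
  set D : ℝ := ((m * (2 * h)).factorial : ℝ) * (r : ℝ) ^ (m * (2 * h)) with hD
  have hDpos : 0 < D := by positivity
  have hsplit : ∀ k : ℕ, (blockProd r (2 * h) m).eval (k : ℝ) *
      (Real.eulerMascheroniConstant - eulerPartialSum (r * k + (m * (2 * h + 1) - h))) =
      (blockProd r (2 * h) m).eval (k : ℝ) * Real.eulerMascheroniConstant -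
        ((2 * h).factorial : ℝ) ^ m *
          ((∏ j ∈ Finset.Icc 1 m, ((r * k + j * (2 * h) + j).choose (2 * h) : ℝ)) *
            eulerPartialSum (r * k + (m * (2 * h + 1) - h))) := by
    intro k
    rw [mul_sub]
    congr 1
    rw [eval_blockProd, mul_assoc]
  rw [altSum_congr hsplit, altSum_sub, altSum_mul_const, altSum_const_mul, hone] at hle
  set T := altSum (m * (2 * h)) fun k =>
    (∏ j ∈ Finset.Icc 1 m, ((r * k + j * (2 * h) + j).choose (2 * h) : ℝ)) *
      eulerPartialSum (r * k + (m * (2 * h + 1) - h))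
  have hfac : Real.eulerMascheroniConstant - ((2 * h).factorial : ℝ) ^ m / D * T =
      (D * Real.eulerMascheroniConstant - ((2 * h).factorial : ℝ) ^ m * T) / D := by
    field_simp
  rw [hfac, abs_div, abs_of_pos hDpos, div_le_iff₀ hDpos]
  refine hle.trans (le_of_eq ?_)
  rw [hD]
  ring

theorem mainTheorem11 (c m r : ℕ) (hc : 1 ≤ c) (hm : 1 ≤ m) (hr : 1 ≤ r)
    (n : ℕ) (hn : 1 ≤ n) :
    |Real.eulerMascheroniConstant -
        (((2 * c * n).factorial : ℝ) ^ m /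
            (((2 * m * c * n).factorial : ℝ) * (r : ℝ) ^ (2 * m * c * n))) *
          ∑ k ∈ Finset.range (2 * m * c * n + 1),
            (-1 : ℝ) ^ k * ((2 * m * c * n).choose k : ℝ) *
              (∏ j ∈ Finset.Icc 1 m, ((r * k + 2 * j * c * n + j).choose (2 * c * n) : ℝ)) *
              eulerPartialSum (r * k + (2 * m - 1) * c * n + m)| <
      (m : ℝ) ^ m / ((m - 1).factorial : ℝ) *
        ((4 : ℝ) ^ (-(c : ℝ)) *
            (1 - 1 / (2 * (m : ℝ))) ^ ((2 * (m : ℝ) - 1) * (c : ℝ) / (r : ℝ)) /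
          ((r : ℝ) + 1 - 1 / (2 * (m : ℝ))) ^
            (2 * (m : ℝ) * (c : ℝ) + (2 * (m : ℝ) - 1) * (c : ℝ) / (r : ℝ))) ^ n := by
  have hm0 : (1 : ℝ) ≤ m := by exact_mod_cast hm
  have hδ : (0 : ℝ) < 1 - 1 / (2 * (m : ℝ)) := by
    rw [sub_pos, div_lt_one (by positivity)]
    linarith
  have hcast : (((2 * m - 1) * c : ℕ) : ℝ) = (2 * (m : ℝ) - 1) * c := by
    rw [Nat.cast_mul, Nat.cast_sub (by omega)]
    push_cast
    ring
  rw [add_sub_assoc]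
  set δ : ℝ := 1 - 1 / (2 * (m : ℝ)) with hδdef
  set Y : ℝ := δ ^ ((2 * (m : ℝ) - 1) * (c : ℝ) / (r : ℝ)) /
    (r + δ) ^ (2 * (m : ℝ) * (c : ℝ) + (2 * (m : ℝ) - 1) * (c : ℝ) / (r : ℝ)) with hY
  have hr0 : (0 : ℝ) < r := by positivity
  have hYpos : 0 < Y := by
    have := Real.rpow_pos_of_pos hδ ((2 * (m : ℝ) - 1) * (c : ℝ) / (r : ℝ))
    positivity
  have hsup : ∀ x : ℝ, 0 ≤ x → x ≤ 1 →
      x ^ ((2 * m - 1) * (c * n)) * (1 - x ^ r) ^ (m * (2 * (c * n))) ≤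
        (r : ℝ) ^ (m * (2 * (c * n))) * Y ^ n := by
    intro x hx0 hx1
    -- Here `δ = (2m-1)c / (2mc)`. The maximum is taken with `n` removed from the exponents, then
    -- raised to the power `n`.
    have h := pow_mul_one_sub_pow_le (α := (2 * m - 1) * c) (β := 2 * m * c) hr
      (Nat.mul_pos (by omega) hc) (Nat.mul_pos (by omega) hc) hδ (by
        rw [hcast, hδdef]
        push_cast
        field_simp) hx0 hx1
    rw [hcast] at h
    push_cast at h
    have h0 : 0 ≤ 1 - x ^ r := sub_nonneg.mpr (pow_le_one₀ hx0 hx1)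
    have := pow_le_pow_left₀ (by positivity) h n
    rw [mul_pow, mul_pow, ← pow_mul, ← pow_mul, ← pow_mul] at this
    rw [← mul_assoc, show m * (2 * (c * n)) = 2 * m * c * n by ring]
    exact this
  have hmain := abs_eulerMascheroniConstant_sub_le hr (Nat.mul_pos hc hn) hm hsup
  have hq : ∀ k, r * k + (m * (2 * (c * n) + 1) - c * n) = r * k + (2 * m - 1) * c * n + m := by
    intro k
    obtain ⟨M, rfl⟩ : ∃ j, m = j + 1 := ⟨m - 1, by omega⟩
    rw [show 2 * (M + 1) - 1 = 2 * M + 1 by omega, add_assoc]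
    congr 1
    symm
    apply Nat.eq_sub_of_add_eq
    ring
  have e1 : m * (2 * (c * n)) = 2 * m * c * n := by ring
  have e2 : 2 * (c * n) = 2 * c * n := by ring
  have e3 : ∀ j : ℕ, j * (2 * c * n) = 2 * j * c * n := fun j => by ring
  simp only [altSum, hq, e1] at hmain
  simp only [e2, e3, ← mul_assoc] at hmain
  refine lt_of_le_of_lt hmain ?_
  have h4 : (4 : ℝ) ^ (-(c : ℝ)) = (1 / 4) ^ c := by
    rw [Real.rpow_neg (by norm_num), Real.rpow_natCast, one_div, inv_pow]
  rw [mul_div_assoc, ← hY, h4, mul_pow, ← pow_mul, ← mul_assoc ((m : ℝ) ^ m / _)]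
  refine mul_lt_mul_of_pos_left ?_ (by positivity)
  -- Strictness comes from the factor `1/(m+1)` alone.
  exact div_lt_self (by positivity) (by linarith)
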